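/- Let $p$ be a probability distribution on $\mathbb{N}=\{0,1,2,\dots\}$ and write $H(p)=-\sum_{n\ge 0}p_n\ln p_n\in[0,\infty]$ for its Shannon entropy (with $0\ln 0=0$). For $0\le\lambda\le 1$ the thinning $T_\lambda(p)$ is the law of $\sum_{i=1}^{N}B_i$, where $N$ has law $p$ and $B_1,B_2,\dots$ are Bernoulli variables of parameter $\lambda$, independent of each other and of $N$; that is, $$[T_\lambda(p)]_n=\sum_{k\ge n}\binom{k}{n}\lambda^n(1-\lambda)^{k-n}\,p_k .$$ Let $g(x)=(x+1)\ln(x+1)-x\ln x$ for $x\in[0,\infty)$ (so $g(0)=0$), and $g(\infty)=\infty$; $g$ is an increasing bijection of $[0,\infty]$ onto itself, with inverse $g^{-1}$. For $E\ge 0$ let $\omega_E$ be the geometric distribution of mean $E$, $(\omega_E)_n=\frac{1}{E+1}\left(\frac{E}{E+1}\right)^n$. **Theorem.** Let $0\le\lambda\le1$. 1. For every probability distribution $p$ on $\mathbb{N}$, $$H(T_\lambda(p))\ \ge\ g\big(\lambda\,g^{-1}(H(p))\big),$$ with the convention $0\cdot\infty=0$. In particular $H(T_\lambda(p))=\infty$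 if $H(p)=\infty$ and $\lambda>0$. 2. Geometric inputs minimize the output entropy of the thinning for fixed input entropy: for every $E\ge0$ one has $H(T_\lambda(\omega_E))=g\big(\lambda\,g^{-1}(H(\omega_E))\big)$, and $H(T_\lambda(\omega_E))\le H(T_\lambda(p))$ for every probability distribution $p$ on $\mathbb{N}$ with $H(p)=H(\omega_E)$. Moreover every finite value $S\ge 0$ of the entropy is attained by a geometric distribution: there is $E\ge0$ with $H(\omega_E)=S$. -/

import Mathlib

open scoped ENNReal NNReal

namespace Thinning

/-- The Shannon entropy `H(p) = -∑ₙ pₙ ln pₙ` (natural logarithm, `0 ln 0 = 0`) of a probability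
distribution on `ℕ`. All the terms are nonnegative, and the sum is taken in `[0, ∞]`. -/
noncomputable def entropy (p : PMF ℕ) : ℝ≥0∞ :=
  ∑' n, ENNReal.ofReal (Real.negMulLog (p n).toReal)

/-- The thinning `T_l`: if `N` has law `p`, then `T_l(p)` is the law of `B₁ + ⋯ + B_N` with `Bᵢ`
independent Bernoulli variables of parameter `l`, i.e. given `N = k` the output is binomial with
parameters `k` and `l`. -/
noncomputable def thin (l : unitInterval) (p : PMF ℕ) : PMF ℕ :=
  p.bind fun k => (ProbabilityTheory.binomial k l).toPMF

/-- The transition probabilities of the thinning, spelled out. -/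
theorem thin_apply (l : unitInterval) (p : PMF ℕ) (n : ℕ) :
    thin l p n =
      ∑' k, p k * ENNReal.ofReal ((k.choose n : ℝ) * (l : ℝ) ^ n * (1 - (l : ℝ)) ^ (k - n)) := by
  simp only [thin, PMF.bind_apply]
  refine tsum_congr fun k => ?_
  rw [MeasureTheory.Measure.toPMF_apply, ProbabilityTheory.binomial_singleton]

/-- The geometric distribution on `ℕ` with mean `E`, of success probability `1 / (E + 1)`. -/
noncomputable def geom (E : ℝ≥0) : PMF ℕ :=
  (ProbabilityTheory.geometricMeasure
    (⟨1 / ((E : ℝ) + 1), by positivity,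
      (div_le_one (by positivity)).2 (by simp)⟩ : unitInterval)).toPMF

theorem geom_apply (E : ℝ≥0) (n : ℕ) :
    geom E n = ENNReal.ofReal (1 / ((E : ℝ) + 1) * ((E : ℝ) / ((E : ℝ) + 1)) ^ n) := by
  have h : (E : ℝ) + 1 ≠ 0 := by positivity
  rw [geom, MeasureTheory.Measure.toPMF_apply, ProbabilityTheory.geometricMeasure_singleton]
  · congr 1
    have : 1 - 1 / ((E : ℝ) + 1) = (E : ℝ) / ((E : ℝ) + 1) := by field_simp; ring
    simp only [this]
    ring
  · intro h0
    have := congrArg Subtype.val h0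
    simp [h] at this

/-- The function `g(x) = (x + 1) ln (x + 1) - x ln x`. -/
noncomputable def gReal (x : ℝ) : ℝ := (x + 1) * Real.log (x + 1) - x * Real.log x

theorem gReal_zero : gReal 0 = 0 := by simp [gReal]

theorem continuous_gReal : Continuous gReal :=
  (Real.continuous_mul_log.comp (continuous_id.add continuous_const)).sub Real.continuous_mul_log

theorem strictMonoOn_gReal : StrictMonoOn gReal (Set.Ici 0) := by
  refine strictMonoOn_of_deriv_pos (convex_Ici 0) continuous_gReal.continuousOn fun x hx => ?_
  have hx0 : 0 < x := by simpa using hx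
  have h1 : HasDerivAt (fun x : ℝ => (x + 1) * Real.log (x + 1)) (Real.log (x + 1) + 1) x := by
    have := (Real.hasDerivAt_mul_log (x := x + 1) (by positivity)).comp_add_const x 1
    simpa using this
  have h2 : HasDerivAt gReal (Real.log (x + 1) + 1 - (Real.log x + 1)) x :=
    h1.sub (Real.hasDerivAt_mul_log hx0.ne')
  rw [h2.deriv]
  have := Real.log_lt_log hx0 (lt_add_one x)
  linarith

theorem gReal_nonneg {x : ℝ} (hx : 0 ≤ x) : 0 ≤ gReal x :=
  gReal_zero ▸ strictMonoOn_gReal.monotoneOn Set.self_mem_Ici hx hx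

theorem exists_gReal_eq {y : ℝ} (hy : 0 ≤ y) : ∃ x, 0 ≤ x ∧ gReal x = y := by
  have hb : (0 : ℝ) ≤ Real.exp y := (Real.exp_pos y).le
  have hge : y ≤ gReal (Real.exp y) := by
    have h1 : y ≤ Real.log (Real.exp y + 1) := by
      rw [Real.le_log_iff_exp_le (by positivity)]; linarith
    have h2 := mul_le_mul_of_nonneg_left h1 hb
    simp only [gReal, Real.log_exp]
    linarith
  obtain ⟨x, hx, hxy⟩ := intermediate_value_Icc hb continuous_gReal.continuousOn
    (⟨by rw [gReal_zero]; exact hy, hge⟩ : y ∈ Set.Icc (gReal 0) (gReal (Real.exp y)))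
  exact ⟨x, hx.1, hxy⟩

/-- The extension of `g` to `[0, ∞]` with `g(∞) = ∞`. -/
noncomputable def gFun (x : ℝ≥0∞) : ℝ≥0∞ :=
  if x = ⊤ then ⊤ else ENNReal.ofReal (gReal x.toReal)

theorem strictMono_gFun : StrictMono gFun := by
  intro a b hab
  have ha : a ≠ ⊤ := hab.ne_top
  by_cases hb : b = ⊤
  · simp [gFun, ha, hb]
  · have hlt : a.toReal < b.toReal := (ENNReal.toReal_lt_toReal ha hb).2 hab
    have h := strictMonoOn_gReal (Set.mem_Ici.2 ENNReal.toReal_nonneg)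
      (Set.mem_Ici.2 ENNReal.toReal_nonneg) hlt
    simp only [gFun, ha, hb, if_false]
    exact (ENNReal.ofReal_lt_ofReal_iff ((gReal_nonneg ENNReal.toReal_nonneg).trans_lt h)).2 h

theorem surjective_gFun : Function.Surjective gFun := by
  intro y
  by_cases hy : y = ⊤
  · exact ⟨⊤, by simp [gFun, hy]⟩
  · obtain ⟨x, hx, hxy⟩ := exists_gReal_eq (y := y.toReal) ENNReal.toReal_nonneg
    exact ⟨ENNReal.ofReal x, by simp [gFun, ENNReal.toReal_ofReal hx, hxy, hy]⟩

/-- `g` as an increasing bijection of `[0, ∞]`; its inverse `g⁻¹` is `g.symm`. -/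
noncomputable def g : ℝ≥0∞ ≃o ℝ≥0∞ :=
  StrictMono.orderIsoOfSurjective gFun strictMono_gFun surjective_gFun

end Thinning

namespace Thinning

open Finset Real Filter Topology
open scoped Nat

/-! For finite support, differentiate in `λ`: the derivative of `H(T_λ p)` in `ln λ` is
`production`, and a geometric law of mean `E` thins to one of mean `λE` (`thin_geom`). It therefore
suffices to show that `H ≤ g(E)` forces `production ≤ E ln((E+1)/E)`, the geometric value
(`production_le`). `nonneg_of_deriv_nonpos_of_neg` integrates this backwards from `λ = 1`.

Decreasing rearrangement only raises the production (`production_le_production_perm`), so let `p` be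
decreasing. Pass to the density `Q(x) = e⁻ˣ ∑ pₖ xᵏ/k!`, a mixture of Gamma laws, which is
exponential of mean `E + 1` when `p` is geometric of mean `E`. Three inequalities are combined.
`poisson_logSobolev` bounds the Poisson average of `p log p` by `Q log Q` plus a Bregman term.
`radial_logSobolev` bounds the integral of `Q log Q` by a Fisher information.
`mul_sq_le_add_mul_log`, with joint convexity of the divergence, bounds the Fisher information by
Bregman terms, which integrate to `1 - production`. Formally each is an equality at the geometric
law of mean `E`, so the constants are sharp.

General `p`, including infinite entropy, follows by normalized truncation and a limit. -/

/-! ### Exponential generating polynomials and integration against `e⁻ˣ` -/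

/-- The exponential generating polynomial `∑_{k < N} aₖ xᵏ / k!`. -/
noncomputable def egp (N : ℕ) (a : ℕ → ℝ) (x : ℝ) : ℝ :=
  ∑ k ∈ range N, a k * (x ^ k / k !)

/-- The Bregman divergence `a log (a / b) - a + b` of `x log x`. -/
noncomputable def logBregman (a b : ℝ) : ℝ := a * log (a / b) - a + b

theorem egp_zero_right {N : ℕ} {a : ℕ → ℝ} (ha : ∀ k, N ≤ k → a k = 0) : egp N a 0 = a 0 := by
  cases N with
  | zero => simp [egp, ha 0 le_rfl]
  | succ n => simp [egp, sum_range_succ']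

theorem hasDerivAt_egp {N : ℕ} {a : ℕ → ℝ} (ha : a N = 0) (x : ℝ) :
    HasDerivAt (egp N a) (egp N (fun k => a (k + 1)) x) x := by
  have h1 : HasDerivAt (egp N a) (∑ k ∈ range N, a k * ((k : ℝ) * x ^ (k - 1) / k !)) x := by
    unfold egp
    refine HasDerivAt.fun_sum fun k _ => ?_
    exact ((hasDerivAt_pow k x).div_const _).const_mul _
  convert h1 using 1
  cases N with
  | zero => simp [egp]
  | succ n =>
    rw [sum_range_succ', egp, sum_range_succ]
    simp only [ha, zero_mul, add_zero, Nat.cast_zero, zero_div, mul_zero]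
    refine sum_congr rfl fun k _ => ?_
    have : ((k : ℝ) + 1) ≠ 0 := by positivity
    have h2 : (k ! : ℝ) ≠ 0 := by positivity
    rw [Nat.factorial_succ]
    push_cast
    field_simp

theorem continuous_egp (N : ℕ) (a : ℕ → ℝ) : Continuous (egp N a) := by
  unfold egp
  fun_prop

theorem egp_nonneg {N : ℕ} {a : ℕ → ℝ} (ha : ∀ k, 0 ≤ a k) {x : ℝ} (hx : 0 ≤ x) :
    0 ≤ egp N a x :=
  sum_nonneg fun k _ => mul_nonneg (ha k) (by positivity)

theorem egp_mono {N : ℕ} {a b : ℕ → ℝ} (h : ∀ k, a k ≤ b k) {x : ℝ} (hx : 0 ≤ x) :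
    egp N a x ≤ egp N b x :=
  sum_le_sum fun k _ => mul_le_mul_of_nonneg_right (h k) (by positivity)

theorem le_egp {N : ℕ} (hN : 0 < N) {a : ℕ → ℝ} (ha : ∀ k, 0 ≤ a k) {x : ℝ} (hx : 0 ≤ x) :
    a 0 ≤ egp N a x := by
  have := single_le_sum (f := fun k => a k * (x ^ k / k !)) (s := range N)
    (fun k _ => mul_nonneg (ha k) (by positivity)) (mem_range.2 hN)
  simpa [egp] using this

theorem egp_add (N : ℕ) (a b : ℕ → ℝ) (x : ℝ) :
    egp N (fun k => a k + b k) x = egp N a x + egp N b x := by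
  simp [egp, add_mul, sum_add_distrib]

theorem egp_const_mul (N : ℕ) (c : ℝ) (a : ℕ → ℝ) (x : ℝ) :
    egp N (fun k => c * a k) x = c * egp N a x := by
  simp [egp, mul_sum, mul_assoc]

theorem egp_sub (N : ℕ) (a b : ℕ → ℝ) (x : ℝ) :
    egp N (fun k => a k - b k) x = egp N a x - egp N b x := by
  simp [egp, sub_mul, sum_sub_distrib]

theorem egp_succ {N : ℕ} {a : ℕ → ℝ} (ha : a N = 0) (x : ℝ) : egp (N + 1) a x = egp N a x := by
  simp [egp, sum_range_succ, ha]

/-- The factor `k` kills the spurious term created by `0 - 1 = 0`. -/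
theorem mul_egp (N : ℕ) (a : ℕ → ℝ) (x : ℝ) :
    x * egp N a x = egp (N + 1) (fun k => k * a (k - 1)) x := by
  rw [egp, egp, sum_range_succ', mul_sum]
  simp only [Nat.cast_zero, zero_mul, add_zero, Nat.add_sub_cancel]
  refine sum_congr rfl fun k _ => ?_
  have h2 : (k ! : ℝ) ≠ 0 := by positivity
  have : ((k : ℝ) + 1) ≠ 0 := by positivity
  rw [Nat.factorial_succ]
  push_cast
  field_simp
  ring

theorem tendsto_exp_neg_mul_egp (N : ℕ) (a : ℕ → ℝ) :
    Tendsto (fun x => exp (-x) * egp N a x) atTop (𝓝 0) := by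
  have h : Tendsto (fun x => ∑ k ∈ range N, a k / k ! * (x ^ k * exp (-x))) atTop
      (𝓝 (∑ k ∈ range N, a k / k ! * 0)) :=
    tendsto_finsetSum _ fun k _ => (tendsto_pow_mul_exp_neg_atTop_nhds_zero k).const_mul _
  simp only [mul_zero, sum_const_zero] at h
  refine h.congr fun x => ?_
  rw [egp, mul_sum]
  exact sum_congr rfl fun k _ => by ring

theorem hasDerivAt_exp_neg_mul {f : ℝ → ℝ} {f' x : ℝ} (hf : HasDerivAt f f' x) :
    HasDerivAt (fun x => exp (-x) * f x) (exp (-x) * (f' - f x)) x := by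
  have h1 : HasDerivAt (fun x : ℝ => exp (-x)) (-exp (-x)) x := by
    simpa using (hasDerivAt_neg x).exp
  exact (h1.fun_mul hf).congr_deriv (by ring)

/-- The sum `∑_{j ≤ k < N} aₖ`. -/
noncomputable def tailSum (N : ℕ) (a : ℕ → ℝ) (j : ℕ) : ℝ := ∑ k ∈ Ico j N, a k

theorem tailSum_of_le {N j : ℕ} (a : ℕ → ℝ) (h : N ≤ j) : tailSum N a j = 0 := by
  simp [tailSum, h]

theorem tailSum_zero (N : ℕ) (a : ℕ → ℝ) : tailSum N a 0 = ∑ k ∈ range N, a k := by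
  rw [tailSum, range_eq_Ico]

theorem tailSum_succ {N j : ℕ} (a : ℕ → ℝ) (h : j < N) :
    tailSum N a (j + 1) = tailSum N a j - a j := by
  rw [tailSum, tailSum, sum_eq_sum_Ico_succ_bot h]
  ring

/-- Hence `e⁻ˣ egp N (tailSum N a) x` is the integral of `e⁻ᵗ egp N a t` over `[x, ∞)`; this
replaces integration below. -/
theorem hasDerivAt_egp_tailSum (N : ℕ) (a : ℕ → ℝ) (x : ℝ) :
    HasDerivAt (egp N (tailSum N a)) (egp N (tailSum N a) x - egp N a x) x := by
  convert hasDerivAt_egp (tailSum_of_le a le_rfl) x using 1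
  rw [← egp_sub]
  exact sum_congr rfl fun k hk => by simp only [tailSum_succ a (mem_range.1 hk)]

/-- If `e⁻ˣ ∑ rₖ xᵏ / k!` is at most the derivative of a function that vanishes at `0` and at
infinity, then its integral `∑ rₖ` is nonpositive. -/
theorem sum_nonpos_of_exp_neg_mul_egp_le {N : ℕ} {r : ℕ → ℝ} {W W' : ℝ → ℝ}
    (hW : ContinuousOn W (Set.Ici 0)) (hW' : ∀ x, 0 < x → HasDerivAt W (W' x) x) (h0 : W 0 = 0)
    (hlim : Tendsto W atTop (𝓝 0)) (h : ∀ x, 0 < x → exp (-x) * egp N r x ≤ W' x) :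
    ∑ k ∈ range N, r k ≤ 0 := by
  set V : ℝ → ℝ := fun x => W x + exp (-x) * egp N (tailSum N r) x with hV
  have hd : ∀ x, 0 < x → HasDerivAt V (W' x - exp (-x) * egp N r x) x := fun x hx => by
    exact ((hW' x hx).fun_add (hasDerivAt_exp_neg_mul (hasDerivAt_egp_tailSum N r x))).congr_deriv
      (by ring)
  have hmono : MonotoneOn V (Set.Ici 0) := by
    refine monotoneOn_of_deriv_nonneg (convex_Ici 0) ?_ ?_ ?_
    · exact hW.add (by have := continuous_egp N (tailSum N r); fun_prop)
    · intro x hx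
      rw [interior_Ici] at hx
      exact (hd x hx).differentiableAt.differentiableWithinAt
    · intro x hx
      rw [interior_Ici] at hx
      rw [(hd x hx).deriv]
      linarith [h x hx]
  have hV0 : V 0 = ∑ k ∈ range N, r k := by
    simp [hV, h0, egp_zero_right (fun k hk => tailSum_of_le (N := N) r hk), tailSum_zero]
  have hVlim : Tendsto V atTop (𝓝 0) := by
    simpa using hlim.add (tendsto_exp_neg_mul_egp N (tailSum N r))
  rw [← hV0]
  refine ge_of_tendsto hVlim ?_
  filter_upwards [eventually_ge_atTop 0] with x hx
  exact hmono Set.self_mem_Ici hx hx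

/-! ### Joint convexity of the divergence and the Poisson inequality -/

/-- The left side is linear in `(a, b)` for fixed `r`, with equality at `r = a / b`: the divergence
is a supremum of linear forms. -/
theorem le_logBregman {a b r : ℝ} (ha : 0 ≤ a) (hb : 0 ≤ b) (hab : b = 0 → a = 0) (hr : 0 < r) :
    a * log r - b * r + b ≤ logBregman a b := by
  rcases ha.eq_or_lt with rfl | ha
  · simp only [logBregman, zero_mul]
    nlinarith
  have hb : 0 < b := hb.lt_of_ne fun h => ha.ne' (hab h.symm)
  have h := log_le_sub_one_of_pos (x := r * b / a) (by positivity)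
  rw [log_div (by positivity) ha.ne', log_mul hr.ne' hb.ne'] at h
  rw [logBregman, log_div ha.ne' hb.ne']
  have h2 := mul_le_mul_of_nonneg_left h ha.le
  have h3 : a * (r * b / a - 1) = r * b - a := by field_simp
  linarith

/-- Joint convexity and homogeneity: sum the linear lower bounds at a common `r`, then optimize over
`r`. -/
theorem logBregman_egp_le {N : ℕ} {a b : ℕ → ℝ} (ha : ∀ k, 0 ≤ a k) (hb : ∀ k, 0 ≤ b k)
    (hab : ∀ k, b k = 0 → a k = 0) {x : ℝ} (hx : 0 ≤ x) :
    logBregman (egp N a x) (egp N b x) ≤ egp N (fun k => logBregman (a k) (b k)) x := by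
  have key : ∀ r, 0 < r → egp N a x * log r - egp N b x * r + egp N b x ≤
      egp N (fun k => logBregman (a k) (b k)) x := fun r hr => by
    have := egp_mono (N := N) (fun k => le_logBregman (ha k) (hb k) (hab k) hr) hx
    refine le_trans (le_of_eq ?_) this
    simp only [egp, sum_mul, ← sum_sub_distrib, ← sum_add_distrib]
    exact sum_congr rfl fun k _ => by ring
  rcases (egp_nonneg (N := N) hb hx).eq_or_lt with hB | hB
  · have := key 1 one_pos
    simpa [logBregman, ← hB, (egp_nonneg (N := N) ha hx)] using
      this.trans' (by simp [← hB, egp_nonneg (N := N) ha hx])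
  rcases (egp_nonneg (N := N) ha hx).eq_or_lt with hA | hA
  · rw [← hA] at key ⊢
    simp only [logBregman, zero_mul, zero_sub, neg_zero, zero_add]
    -- The optimal `r` is `0`, which is only approached.
    refine le_of_forall_pos_le_add fun ε hε => ?_
    have h1 := key (ε / egp N b x) (by positivity)
    have h2 : egp N b x * (ε / egp N b x) = ε := by field_simp
    simp only [logBregman] at h1
    linarith
  · have h1 := key (egp N a x / egp N b x) (by positivity)
    have h2 : egp N b x * (egp N a x / egp N b x) = egp N a x := by field_simp
    rw [h2] at h1
    exact h1

/-- Modified logarithmic Sobolev inequality for the Poisson distribution. -/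
theorem poisson_logSobolev {N : ℕ} {p : ℕ → ℝ} (hpos : ∀ k < N, 0 < p k)
    (hzero : ∀ k, N ≤ k → p k = 0) {n : ℕ} (hn : n ≤ N) {x : ℝ} (hx : 0 ≤ x) :
    egp N (fun k => p (n + k) * log (p (n + k))) x ≤
      egp N (fun k => p (n + k)) x * (log (egp N (fun k => p (n + k)) x) - x) +
        x * egp N (fun k => logBregman (p (n + k + 1)) (p (n + k))) x := by
  have hnn : ∀ k, 0 ≤ p k := fun k => by
    rcases lt_or_ge k N with h | h
    exacts [(hpos k h).le, (hzero k h).ge]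
  -- Differentiating in `x` turns the shift `n` into `n + 1`, and the shift `N` is trivial.
  induction hn using Nat.decreasingInduction generalizing x with
  | self =>
    have h0 : ∀ k, p (N + k) = 0 := fun k => hzero _ (by omega)
    simp [egp, h0, logBregman, add_assoc]
  | of_succ n hn ih =>
    set q : ℕ → ℝ → ℝ := fun m => egp N (fun k => p (m + k)) with hq
    set F : ℕ → ℝ → ℝ := fun m => egp N (fun k => p (m + k) * log (p (m + k))) with hF
    set B : ℕ → ℝ → ℝ := fun m => egp N (fun k => logBregman (p (m + k + 1)) (p (m + k))) with hB
    have hs : ∀ k, n + 1 + k = n + (k + 1) := fun k => by omega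
    have hqd : ∀ x, HasDerivAt (q n) (q (n + 1) x) x := fun x => by
      have := hasDerivAt_egp (N := N) (a := fun k => p (n + k)) (hzero _ (by omega)) x
      simpa only [hq, hs] using this
    have hFd : ∀ x, HasDerivAt (F n) (F (n + 1) x) x := fun x => by
      have := hasDerivAt_egp (N := N) (a := fun k => p (n + k) * log (p (n + k)))
        (by simp [hzero (n + N) (by omega)]) x
      simpa only [hF, hs] using this
    have hBd : ∀ x, HasDerivAt (B n) (B (n + 1) x) x := fun x => by
      have := hasDerivAt_egp (N := N) (a := fun k => logBregman (p (n + k + 1)) (p (n + k)))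
        (by simp [logBregman, hzero (n + N) (by omega), hzero (n + N + 1) (by omega)]) x
      simpa only [hB, hs] using this
    have hqpos : ∀ x, 0 ≤ x → 0 < q n x := fun x hx => by
      have := le_egp (N := N) (a := fun k => p (n + k)) (by omega) (fun k => hnn _) hx
      exact (hpos n hn).trans_le this
    -- With `Z_m` the gap at shift `m`, `Z_n' = Z_{n+1} + (B_n - logBregman q_{n+1} q_n)`: induction
    -- handles the first term, convexity the second.
    set Z : ℝ → ℝ := fun x => q n x * (log (q n x) - x) + x * B n x - F n x with hZ
    have hZd : ∀ x, 0 ≤ x → HasDerivAt Z (q (n + 1) x * (log (q n x) - x) +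
        q n x * (q (n + 1) x / q n x - 1) + (1 * B n x + x * B (n + 1) x) - F (n + 1) x) x :=
      fun x hx => (((hqd x).mul (((hqd x).log (hqpos x hx).ne').sub (hasDerivAt_id x))).add
        ((hasDerivAt_id x).mul (hBd x))).sub (hFd x)
    have hmono : MonotoneOn Z (Set.Ici 0) := by
      refine monotoneOn_of_deriv_nonneg (convex_Ici 0)
        (fun x hx => (hZd x hx).continuousAt.continuousWithinAt) ?_ ?_
      · intro x hx
        rw [interior_Ici] at hx
        exact (hZd x (le_of_lt hx)).differentiableAt.differentiableWithinAt
      · intro x hx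
        rw [interior_Ici] at hx
        have hx0 : 0 ≤ x := le_of_lt hx
        rw [(hZd x hx0).deriv]
        have h1 := ih hx0
        have h2 : logBregman (q (n + 1) x) (q n x) ≤ B n x := by
          have := logBregman_egp_le (N := N) (a := fun k => p (n + k + 1))
            (b := fun k => p (n + k)) (fun k => hnn _) (fun k => hnn _) ?_ hx0
          · simpa only [hq, hB, Nat.add_right_comm n 1] using this
          · intro k hk
            refine hzero _ ?_
            by_contra hlt
            exact (hpos (n + k) (by omega)).ne' hk
        have h3 : q n x * (q (n + 1) x / q n x - 1) = q (n + 1) x - q n x := by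
          have := (hqpos x hx0).ne'
          field_simp
        have h4 : logBregman (q (n + 1) x) (q n x) =
            q (n + 1) x * (log (q (n + 1) x) - log (q n x)) - q (n + 1) x + q n x := by
          rcases eq_or_ne (q (n + 1) x) 0 with h | h
          · simp [logBregman, h]
          · rw [logBregman, log_div h (hqpos x hx0).ne']
        change F (n + 1) x ≤ q (n + 1) x * (log (q (n + 1) x) - x) + x * B (n + 1) x at h1
        rw [h3]
        linarith
    have hZ0 : Z 0 = 0 := by
      have h1 : q n 0 = p n := egp_zero_right (fun k hk => hzero _ (by omega))
      have h2 : F n 0 = p n * log (p n) :=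
        egp_zero_right (fun k hk => by simp [hzero (n + k) (by omega)])
      simp [hZ, h1, h2]
    have := hmono Set.self_mem_Ici hx hx
    rw [hZ0] at this
    simp only [hZ] at this
    change F n x ≤ q n x * (log (q n x) - x) + x * B n x
    linarith

/-! ### A tangent-line inequality in one variable -/

/-- This is `u ≤ sinh u` at `u = -log z`. -/
theorem neg_two_mul_log_le {z : ℝ} (hz : 0 < z) (hz1 : z ≤ 1) : -(2 * log z) ≤ 1 / z - z := by
  have h := self_le_sinh_iff.2 (neg_nonneg.2 (log_nonpos hz.le hz1))
  rw [sinh_eq, neg_neg, exp_log hz, exp_neg, exp_log hz] at h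
  rw [one_div]
  linarith

/-- The function is the derivative of `(1 - y) log (1 - y) / y`, whose convexity is wanted. -/
theorem monotoneOn_neg_log_one_sub_div_sq :
    MonotoneOn (fun y : ℝ => -log (1 - y) / y ^ 2 - 1 / y) (Set.Ioo 0 1) := by
  have hd : ∀ y ∈ Set.Ioo (0 : ℝ) 1, HasDerivAt (fun y : ℝ => -log (1 - y) / y ^ 2 - 1 / y)
      ((1 / (1 - y) + 2 * log (1 - y) / y + 1) / y ^ 2) y := fun y ⟨h0, h1⟩ => by
    have hz : 1 - y ≠ 0 := by linarith
    have h2 : HasDerivAt (fun y : ℝ => -log (1 - y)) (-(-1 / (1 - y))) y :=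
      (((hasDerivAt_id y).const_sub 1).log hz).neg
    have h3 := (h2.fun_div (hasDerivAt_pow 2 y) (by positivity)).fun_sub
      ((hasDerivAt_const y (1 : ℝ)).fun_div (hasDerivAt_id y) h0.ne')
    refine h3.congr_deriv ?_
    have := h0.ne'
    simp only [id]
    field_simp
    ring
  refine monotoneOn_of_deriv_nonneg (convex_Ioo 0 1)
    (fun y hy => (hd y hy).continuousAt.continuousWithinAt) ?_ ?_ <;> rw [interior_Ioo]
  · exact fun y hy => (hd y hy).differentiableAt.differentiableWithinAt
  · intro y hy
    rw [(hd y hy).deriv]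
    obtain ⟨h0, h1⟩ := hy
    have hz : 0 < 1 - y := by linarith
    have h := neg_two_mul_log_le hz (by linarith)
    refine div_nonneg ?_ (by positivity)
    have h4 : (1 / (1 - y) - (1 - y)) / y = 1 / (1 - y) + 1 := by field_simp; ring
    have h5 := div_le_div_of_nonneg_right h h0.le
    rw [h4, neg_div] at h5
    linarith

/-- The tangent line at `y₀` to the concave function `y ↦ -(1 - y) log (1 - y) / y`. -/
theorem neg_mul_log_one_sub_le {y y₀ : ℝ} (hy : y ∈ Set.Ioo (0 : ℝ) 1)
    (hy₀ : y₀ ∈ Set.Ioo (0 : ℝ) 1) :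
    -((1 - y) * log (1 - y) / y) ≤ -((1 - y₀) * log (1 - y₀) / y₀) -
      (-log (1 - y₀) / y₀ ^ 2 - 1 / y₀) * (y - y₀) := by
  set v : ℝ → ℝ := fun y => -log (1 - y) / y ^ 2 - 1 / y with hv
  set D : ℝ → ℝ := fun y => (1 - y) * log (1 - y) / y - v y₀ * y with hD
  have hd : ∀ y ∈ Set.Ioo (0 : ℝ) 1, HasDerivAt D (v y - v y₀) y := fun y ⟨h0, h1⟩ => by
    have hz : 1 - y ≠ 0 := by linarith
    have h1 := (hasDerivAt_id y).const_sub 1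
    have h3 := (((h1.fun_mul (h1.log hz)).fun_div (hasDerivAt_id y) h0.ne')).fun_sub
      ((hasDerivAt_id y).const_mul (v y₀))
    refine h3.congr_deriv ?_
    have := h0.ne'
    simp only [id, hv]
    field_simp
    ring
  have hmono := monotoneOn_neg_log_one_sub_div_sq
  have key : D y₀ ≤ D y := by
    rcases le_total y y₀ with h | h
    · have hsub : Set.Icc y y₀ ⊆ Set.Ioo 0 1 := fun z hz => ⟨hy.1.trans_le hz.1, hz.2.trans_lt hy₀.2⟩
      have : AntitoneOn D (Set.Icc y y₀) := by
        refine antitoneOn_of_deriv_nonpos (convex_Icc _ _)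
          (fun z hz => (hd z (hsub hz)).continuousAt.continuousWithinAt) ?_ ?_ <;>
          intro z hz <;> have hz := interior_subset hz
        · exact (hd z (hsub hz)).differentiableAt.differentiableWithinAt
        · rw [(hd z (hsub hz)).deriv]
          exact sub_nonpos.2 (hmono (hsub hz) hy₀ hz.2)
      exact this ⟨le_rfl, h⟩ ⟨h, le_rfl⟩ h
    · have hsub : Set.Icc y₀ y ⊆ Set.Ioo 0 1 := fun z hz => ⟨hy₀.1.trans_le hz.1, hz.2.trans_lt hy.2⟩
      have : MonotoneOn D (Set.Icc y₀ y) := by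
        refine monotoneOn_of_deriv_nonneg (convex_Icc _ _)
          (fun z hz => (hd z (hsub hz)).continuousAt.continuousWithinAt) ?_ ?_ <;>
          intro z hz <;> have hz := interior_subset hz
        · exact (hd z (hsub hz)).differentiableAt.differentiableWithinAt
        · rw [(hd z (hsub hz)).deriv]
          exact sub_nonneg.2 (hmono hy₀ (hsub hz) hz.1)
      exact this ⟨le_rfl, h⟩ ⟨h, le_rfl⟩ h
  simp only [hD] at key
  change _ ≤ _ - v y₀ * (y - y₀)
  linarith

theorem one_lt_mul_log {E : ℝ} (hE : 0 < E) : 1 < (E + 1) * log ((E + 1) / E) := by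
  have h : log (E / (E + 1)) < E / (E + 1) - 1 :=
    log_lt_sub_one_of_pos (by positivity) (by rw [Ne, div_eq_one_iff_eq (by positivity)]; linarith)
  rw [← inv_div, log_inv] at h
  have h2 := mul_lt_mul_of_pos_left h (show 0 < E + 1 by linarith)
  have h3 : (E + 1) * (((E + 1) / E)⁻¹ - 1) = -1 := by field_simp; ring
  linarith

/-- The tangent bound at `y₀ = 1 / (E + 1)`, multiplied by `y`. This `y₀` is the value of `-Q'/Q`
for a geometric law of mean `E`. -/
theorem mul_sq_le_add_mul_log {E : ℝ} (hE : 0 < E) {y : ℝ} (h0 : 0 ≤ y) (h1 : y ≤ 1) :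
    (E + 1) * ((E + 1) * log ((E + 1) / E) - 1) * y ^ 2 ≤
      ((2 * E + 1) * log ((E + 1) / E) - 1) * y + (1 - y) * log (1 - y) := by
  set L := log ((E + 1) / E) with hL
  have hE1 : 0 < E + 1 := by linarith
  rcases h0.eq_or_lt with rfl | h0
  · simp
  rcases h1.eq_or_lt with rfl | h1
  · have : L ≤ (E + 1) / E - 1 := log_le_sub_one_of_pos (by positivity)
    have h2 := mul_le_mul_of_nonneg_left this (sq_nonneg E)
    have h3 : E ^ 2 * ((E + 1) / E - 1) = E := by field_simp; ring
    simp only [sub_self, zero_mul]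
    nlinarith
  have hy₀ : 1 / (E + 1) ∈ Set.Ioo (0 : ℝ) 1 :=
    ⟨by positivity, by rw [div_lt_one hE1]; linarith⟩
  have h := neg_mul_log_one_sub_le ⟨h0, h1⟩ hy₀
  have hlog : log (1 - 1 / (E + 1)) = -L := by
    rw [hL, ← log_inv, inv_div]
    congr 1
    field_simp
    ring
  rw [hlog] at h
  have h2 := mul_le_mul_of_nonneg_left h h0.le
  have h3 : y * -((1 - y) * log (1 - y) / y) = -((1 - y) * log (1 - y)) := by field_simp
  have h4 : y * (-((1 - 1 / (E + 1)) * -L / (1 / (E + 1))) -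
      (- -L / (1 / (E + 1)) ^ 2 - 1 / (1 / (E + 1))) * (y - 1 / (E + 1))) =
      ((2 * E + 1) * L - 1) * y - (E + 1) * ((E + 1) * L - 1) * y ^ 2 := by
    field_simp
    ring
  rw [h3, h4] at h2
  linarith

/-! ### Radial logarithmic Sobolev inequality by transport -/

/-- Differential form of the logarithmic Sobolev inequality for radial densities on the plane,
obtained by transport to the exponential distribution. Here `Q` is a density on `[0, ∞)`, with
`Q' = -y Q`, and `exp (-T)` is its survival function. -/
theorem radial_logSobolev {Q T : ℝ → ℝ} {M x y : ℝ} (hM : 0 < M) (hx : 0 < x) (hT0 : 0 < T x)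
    (hQ0 : 0 < Q x) (hQ : HasDerivAt Q (-(y * Q x)) x) (hT : HasDerivAt T (exp (T x) * Q x) x) :
    ∃ w, HasDerivAt (fun x => 2 * √M * (Q x * √(x * T x))) w x ∧
      Q x * log (Q x) ≤ w - (2 + log M) * Q x + M * x * y ^ 2 * Q x := by
  set T' := exp (T x) * Q x with hT'
  have hT'0 : 0 < T' := by positivity
  have hd := (hQ.fun_mul (((hasDerivAt_id x).fun_mul hT).sqrt (mul_pos hx hT0).ne')).const_mul
    (2 * √M)
  refine ⟨_, hd, ?_⟩
  simp only [id, one_mul]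
  obtain ⟨a, ha, rfl⟩ : ∃ a, 0 < a ∧ a ^ 2 = M := ⟨√M, by positivity, sq_sqrt hM.le⟩
  obtain ⟨r, hr, hrx⟩ : ∃ r, 0 < r ∧ r ^ 2 = x := ⟨√x, by positivity, sq_sqrt hx.le⟩
  obtain ⟨t, ht, htT⟩ : ∃ t, 0 < t ∧ t ^ 2 = T x := ⟨√(T x), by positivity, sq_sqrt hT0.le⟩
  have h1 : √(a ^ 2) = a := sqrt_sq ha.le
  have h2 : √(x * T x) = r * t := by
    rw [← sqrt_sq (show 0 ≤ r * t by positivity), mul_pow, hrx, htT]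
  have hlogQ : log (Q x) = log T' - T x := by
    rw [hT', log_mul (exp_pos _).ne' hQ0.ne', log_exp]; ring
  -- With `r = √x` as radius, `r T' / t` and `t / r` are the radial and angular stretch factors of
  -- the planar map `r ↦ t = √T`. The bounds `log z ≤ z - 1` then amount to `log det ≤ trace - 2`.
  have h3 : log T' = log (a * (r * T' / t)) + log (a * (t / r)) - log (a ^ 2) := by
    rw [← log_mul (by positivity) (by positivity), ← log_div (by positivity) (by positivity)]
    congr 1
    field_simp
  have h4 := log_le_sub_one_of_pos (x := a * (r * T' / t)) (by positivity)
  have h5 := log_le_sub_one_of_pos (x := a * (t / r)) (by positivity)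
  have h6 : log (Q x) ≤ a * (r * T' / t) + a * (t / r) - 2 - log (a ^ 2) - T x := by linarith
  have h7 := mul_le_mul_of_nonneg_left h6 hQ0.le
  -- This square absorbs the cross term of `w` and the term `-T` into the Fisher information.
  have h8 : 0 ≤ Q x * (a * r * y - t) ^ 2 := by positivity
  rw [h1, h2]
  have h9 : 2 * a * (-(y * Q x) * (r * t) + Q x * ((T x + x * T') / (2 * (r * t)))) =
      -2 * a * y * Q x * r * t + Q x * (a * (r * T' / t) + a * (t / r)) := by
    rw [← htT, show x * T' = r ^ 2 * T' by rw [hrx]]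
    field_simp
    ring
  rw [h9]
  rw [← htT] at h7
  rw [show a ^ 2 * x * y ^ 2 * Q x = a ^ 2 * r ^ 2 * y ^ 2 * Q x by rw [hrx]]
  linarith

/-! ### Entropy production of decreasing distributions -/

/-- The entropy production `-∑ ṗₖ log pₖ`, up to sign, of the pure death process
`ṗₖ = (k + 1) pₖ₊₁ - k pₖ` generating the thinning. -/
noncomputable def production (N : ℕ) (p : ℕ → ℝ) : ℝ :=
  ∑ k ∈ range N, ((k + 1) * p (k + 1) - k * p k) * log (p k)

theorem sum_succ_mul_succ {N : ℕ} {f : ℕ → ℝ} (hN : f N = 0) :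
    ∑ k ∈ range N, ((k : ℝ) + 1) * f (k + 1) = ∑ k ∈ range N, (k : ℝ) * f k := by
  have h := sum_range_succ' (fun k : ℕ => (k : ℝ) * f k) N
  rw [sum_range_succ] at h
  push_cast at h
  rw [hN] at h
  linarith

/-- The left side is the integral of `x e⁻ˣ` times the Bregman polynomial; this is how the
production enters. -/
theorem sum_succ_mul_logBregman {N : ℕ} {p : ℕ → ℝ} (hpos : ∀ k < N, 0 < p k)
    (hzero : ∀ k, N ≤ k → p k = 0) (hsum : ∑ k ∈ range N, p k = 1) :
    ∑ k ∈ range N, ((k : ℝ) + 1) * logBregman (p (k + 1)) (p k) = 1 - production N p := by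
  have h1 : ∀ k ∈ range N, ((k : ℝ) + 1) * logBregman (p (k + 1)) (p k) =
      ((k : ℝ) + 1) * (p (k + 1) * log (p (k + 1)) - p (k + 1)) -
        ((k : ℝ) * (p k * log (p k) - p k)) + p k -
        ((k + 1) * p (k + 1) - k * p k) * log (p k) := by
    intro k hk
    have hk0 := (hpos k (mem_range.1 hk)).ne'
    rcases eq_or_ne (p (k + 1)) 0 with h | h
    · simp only [logBregman, h]
      ring
    · rw [logBregman, log_div h hk0]
      ring
  rw [sum_congr rfl h1, sum_sub_distrib, sum_add_distrib, sum_sub_distrib,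
    sum_succ_mul_succ (f := fun k => p k * log (p k) - p k) (by simp [hzero N le_rfl]), hsum,
    production]
  ring

theorem gReal_eq_log_add {E : ℝ} (hE : 0 < E) :
    gReal E = log (E + 1) + E * log ((E + 1) / E) := by
  rw [gReal, log_div (by positivity) hE.ne']
  ring

/-- Applies `radial_logSobolev` to `Q = e⁻ˣ egp N p`, with `W` the boundary term `2√M Q √(x T)`; `T
≤ x` makes it vanish at infinity. -/
theorem poissonMixture_logSobolev {N : ℕ} {p : ℕ → ℝ} (hpos : ∀ k < N, 0 < p k)
    (hzero : ∀ k, N ≤ k → p k = 0) (hsum : ∑ k ∈ range N, p k = 1)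
    {M : ℝ} (hM : 0 < M) :
    ∃ W W' : ℝ → ℝ, ContinuousOn W (Set.Ici 0) ∧ (∀ x, 0 < x → HasDerivAt W (W' x) x) ∧ W 0 = 0 ∧
      Tendsto W atTop (𝓝 0) ∧ ∀ x, 0 < x →
        exp (-x) * egp N p x * log (exp (-x) * egp N p x) ≤
          W' x - (2 + log M) * (exp (-x) * egp N p x) +
            M * x * ((egp N p x - egp N (fun k => p (k + 1)) x) / egp N p x) ^ 2 *
              (exp (-x) * egp N p x) := by
  have hN : 0 < N := Nat.pos_of_ne_zero fun h => by simp [h] at hsum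
  have hnn : ∀ k, 0 ≤ p k := fun k => by
    rcases lt_or_ge k N with h | h
    exacts [(hpos k h).le, (hzero k h).ge]
  set q := egp N p with hq
  set q₁ := egp N (fun k => p (k + 1)) with hq₁
  set s := egp N (tailSum N p) with hs
  have hs0 : s 0 = 1 := by
    rw [hs, egp_zero_right (fun k hk => tailSum_of_le p hk), tailSum_zero, hsum]
  have hs1 : ∀ x, 0 ≤ x → 1 ≤ s x := fun x hx => by
    have := le_egp hN (a := tailSum N p) (fun k => sum_nonneg fun _ _ => hnn _) hx
    rwa [tailSum_zero, hsum] at this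
  have hqpos : ∀ x, 0 ≤ x → 0 < q x := fun x hx => (hpos 0 hN).trans_le (le_egp hN hnn hx)
  set Q : ℝ → ℝ := fun x => exp (-x) * q x with hQ
  -- The survival function of `Q` is `e⁻ˣ s(x)`, so this is minus its logarithm.
  set T : ℝ → ℝ := fun x => x - log (s x) with hT
  have hTd : ∀ x, 0 ≤ x → HasDerivAt T (exp (T x) * Q x) x := fun x hx => by
    have hspos : 0 < s x := one_pos.trans_le (hs1 x hx)
    refine ((hasDerivAt_id x).fun_sub
      ((hasDerivAt_egp_tailSum N p x).log hspos.ne')).congr_deriv ?_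
    have : exp (T x) * Q x = q x / s x := by
      simp only [hT, hQ]
      rw [exp_sub, exp_log hspos, exp_neg]
      field_simp
    rw [this]
    change 1 - (s x - q x) / s x = _
    field_simp
    ring
  have hT0 : T 0 = 0 := by simp [hT, hs0]
  have hTpos : ∀ x, 0 < x → 0 < T x := fun x hx => by
    have : StrictMonoOn T (Set.Ici 0) := by
      refine strictMonoOn_of_deriv_pos (convex_Ici 0)
        (fun x hx => (hTd x hx).continuousAt.continuousWithinAt) fun x hx => ?_
      rw [interior_Ici] at hx
      have hx : 0 ≤ x := le_of_lt hx
      rw [(hTd x hx).deriv]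
      exact mul_pos (exp_pos _) (mul_pos (exp_pos _) (hqpos x hx))
    simpa [hT0] using this Set.self_mem_Ici hx.le hx
  have hTle : ∀ x, 0 ≤ x → T x ≤ x := fun x hx => sub_le_self _ (log_nonneg (hs1 x hx))
  have hQd : ∀ x, 0 ≤ x → HasDerivAt Q (-((q x - q₁ x) / q x * Q x)) x := fun x hx => by
    refine (hasDerivAt_exp_neg_mul (hasDerivAt_egp (hzero N le_rfl) x)).congr_deriv ?_
    have := (hqpos x hx).ne'
    change exp (-x) * (q₁ x - q x) = -((q x - q₁ x) / q x * (exp (-x) * q x))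
    field_simp
    ring
  have hmain := fun (x : ℝ) (hx : 0 < x) =>
    radial_logSobolev (Q := Q) (T := T) hM hx (hTpos x hx) (mul_pos (exp_pos _) (hqpos x hx.le)) (hQd x hx.le)
      (hTd x hx.le)
  choose! W' hW' using hmain
  refine ⟨fun x => 2 * √M * (Q x * √(x * T x)), W', ?_, fun x hx => (hW' x hx).1, by simp, ?_,
    fun x hx => (hW' x hx).2⟩
  · have h1 : ContinuousOn Q (Set.Ici 0) := fun x hx => (hQd x hx).continuousAt.continuousWithinAt
    have h2 : ContinuousOn T (Set.Ici 0) := fun x hx => (hTd x hx).continuousAt.continuousWithinAt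
    fun_prop
  · have hlim := (tendsto_exp_neg_mul_egp (N + 1) (fun k => k * p (k - 1))).const_mul (2 * √M)
    rw [mul_zero] at hlim
    refine squeeze_zero' ?_ ?_ hlim
    · filter_upwards [eventually_ge_atTop 0] with x hx
      have : 0 ≤ Q x := (mul_pos (exp_pos _) (hqpos x hx)).le
      positivity
    · filter_upwards [eventually_ge_atTop 0] with x hx
      have hQ0 : 0 ≤ Q x := (mul_pos (exp_pos _) (hqpos x hx)).le
      rw [← mul_egp]
      have h1 : √(x * T x) ≤ x := by
        rw [sqrt_le_left hx, sq]
        exact mul_le_mul_of_nonneg_left (hTle x hx) hx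
      refine mul_le_mul_of_nonneg_left ?_ (by positivity)
      calc Q x * √(x * T x) ≤ Q x * x := mul_le_mul_of_nonneg_left h1 hQ0
        _ = exp (-x) * (x * egp N p x) := by simp only [hQ, hq]; ring

/-- Isoperimetric inequality: among decreasing distributions of given entropy, the geometric one
maximizes the entropy production. -/
theorem production_le_of_antitone {N : ℕ} {p : ℕ → ℝ} (hpos : ∀ k < N, 0 < p k)
    (hzero : ∀ k, N ≤ k → p k = 0) (hanti : Antitone p) (hsum : ∑ k ∈ range N, p k = 1)
    {E : ℝ} (hE : 0 < E) (hH : ∑ k ∈ range N, negMulLog (p k) ≤ gReal E) :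
    production N p ≤ E * log ((E + 1) / E) := by
  have hN : 0 < N := Nat.pos_of_ne_zero fun h => by simp [h] at hsum
  have hnn : ∀ k, 0 ≤ p k := fun k => by
    rcases lt_or_ge k N with h | h
    exacts [(hpos k h).le, (hzero k h).ge]
  set L := log ((E + 1) / E) with hL
  have hML : 0 < (E + 1) * L - 1 := sub_pos.2 (one_lt_mul_log hE)
  have hM : 0 < E + 1 := by linarith
  obtain ⟨W, W', hWc, hWd, hW0, hWlim, hW⟩ :=
    poissonMixture_logSobolev hpos hzero hsum hM
  -- `K` rescales `mul_sq_le_add_mul_log` so that its left side becomes `(E + 1) y²`, the Fisher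
  -- term for `M = E + 1`.
  set K := 1 / ((E + 1) * L - 1) with hK
  have hKpos : 0 < K := by positivity
  -- Coefficients of the combined pointwise inequality. In the Bregman factor `1 + K`, the `1` comes
  -- from the Poisson inequality and `K` from the tangent line; the shifts `k - 1` encode
  -- multiplication by `x`.
  set r : ℕ → ℝ := fun k => p k * log (p k) + (2 + log (E + 1)) * p k -
    ((1 + K) * (k * logBregman (p (k - 1 + 1)) (p (k - 1))) +
      K * ((2 * E + 1) * L - 2) * (k * (p (k - 1) - p (k - 1 + 1)))) with hr
  have hegp : ∀ x, egp (N + 1) r x = egp N (fun k => p k * log (p k)) x +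
      (2 + log (E + 1)) * egp N p x -
        ((1 + K) * (x * egp N (fun k => logBregman (p (k + 1)) (p k)) x) +
          K * ((2 * E + 1) * L - 2) * (x * (egp N p x - egp N (fun k => p (k + 1)) x))) := by
    intro x
    rw [hr, egp_sub, egp_add, egp_add, egp_const_mul, egp_const_mul, egp_const_mul,
      ← egp_sub, mul_egp, mul_egp,
      egp_succ (a := fun k => p k * log (p k)) (by simp [hzero N le_rfl]),
      egp_succ (hzero N le_rfl)]
  have hle := sum_nonpos_of_exp_neg_mul_egp_le (N := N + 1) (r := r) hWc hWd hW0 hWlim ?_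
  · have hsum' : ∑ k ∈ range (N + 1), r k = -∑ k ∈ range N, negMulLog (p k) +
        (2 + log (E + 1)) - ((1 + K) * (1 - production N p) + K * ((2 * E + 1) * L - 2)) := by
      have h1 : ∑ k ∈ range (N + 1), (k : ℝ) * logBregman (p (k - 1 + 1)) (p (k - 1)) =
          1 - production N p := by
        rw [sum_range_succ', ← sum_succ_mul_logBregman hpos hzero hsum]
        simp
      have h2 : ∑ k ∈ range (N + 1), (k : ℝ) * (p (k - 1) - p (k - 1 + 1)) = 1 := by
        have h3 := sum_succ_mul_succ (hzero N le_rfl)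
        rw [sum_range_succ', ← hsum]
        simp only [Nat.add_sub_cancel, Nat.cast_zero, zero_mul, Nat.cast_add,
          Nat.cast_one, mul_sub, sum_sub_distrib]
        rw [h3, ← sum_sub_distrib, sub_zero, add_zero]
        exact sum_congr rfl fun k _ => by ring
      have h4 : ∑ k ∈ range (N + 1), p k * log (p k) = -∑ k ∈ range N, negMulLog (p k) := by
        rw [sum_range_succ, hzero N le_rfl, zero_mul, add_zero, ← sum_neg_distrib]
        exact sum_congr rfl fun k _ => by rw [negMulLog]; ring
      have h5 : ∑ k ∈ range (N + 1), p k = 1 := by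
        rw [sum_range_succ, hzero N le_rfl, add_zero, hsum]
      simp only [hr]
      rw [sum_sub_distrib, sum_add_distrib, sum_add_distrib, ← mul_sum, ← mul_sum, ← mul_sum,
        h1, h2, h4, h5]
      ring
    rw [hsum'] at hle
    rw [gReal_eq_log_add hE, ← hL] at hH
    have h6 : (1 + K) * production N p ≤ E * L - 1 + K * ((2 * E + 1) * L - 1) := by linarith
    have h7 := mul_le_mul_of_nonneg_left h6 hML.le
    have h8 : ((E + 1) * L - 1) * ((1 + K) * production N p) = (E + 1) * L * production N p := by
      rw [hK]
      field_simp
      ring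
    have h9 : ((E + 1) * L - 1) * (E * L - 1 + K * ((2 * E + 1) * L - 1)) =
        (E + 1) * L * (E * L) := by
      rw [hK]
      field_simp
      ring
    rw [h8, h9] at h7
    exact le_of_mul_le_mul_left h7 (by linarith)
  · intro x hx
    have h1 := hW x hx
    rw [hegp]
    have hA := poisson_logSobolev hpos hzero (Nat.zero_le N) hx.le
    have hB := logBregman_egp_le (N := N) (a := fun k => p (k + 1)) (b := p) (fun k => hnn _) hnn
      (fun k hk => hzero _ (by by_contra hlt; exact (hpos k (by omega)).ne' hk)) hx.le
    simp only [zero_add] at hA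
    have hq : 0 < egp N p x := (hpos 0 hN).trans_le (le_egp hN hnn hx.le)
    have hq₁ : 0 ≤ egp N (fun k => p (k + 1)) x := egp_nonneg (fun k => hnn _) hx.le
    -- Monotonicity of `p` serves to place `y = (q - q₁) / q` in `[0, 1]`.
    have hq₁q : egp N (fun k => p (k + 1)) x ≤ egp N p x :=
      egp_mono (fun k => hanti (Nat.le_succ k)) hx.le
    set B := egp N (fun k => logBregman (p (k + 1)) (p k)) x
    set F := egp N (fun k => p k * log (p k)) x
    set q₁ := egp N (fun k => p (k + 1)) x
    set q := egp N p x
    have hy := mul_sq_le_add_mul_log hE (y := (q - q₁) / q) (div_nonneg (by linarith) hq.le)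
      ((div_le_one hq).2 (by linarith))
    rw [← hL, show 1 - (q - q₁) / q = q₁ / q by field_simp; ring] at hy
    have h2 : (E + 1) * ((q - q₁) / q) ^ 2 * q ≤ K * (((2 * E + 1) * L - 1) * (q - q₁) +
        (B - q + q₁)) := by
      have h3 := mul_le_mul_of_nonneg_left hy (mul_pos hKpos hq).le
      have h4 : K * q * ((E + 1) * ((E + 1) * L - 1) * ((q - q₁) / q) ^ 2) =
          (E + 1) * ((q - q₁) / q) ^ 2 * q := by
        rw [hK]
        field_simp
      have h5 : K * q * (((2 * E + 1) * L - 1) * ((q - q₁) / q) + q₁ / q * log (q₁ / q)) =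
          K * (((2 * E + 1) * L - 1) * (q - q₁) + q₁ * log (q₁ / q)) := by
        field_simp
      rw [h4, h5] at h3
      refine h3.trans (mul_le_mul_of_nonneg_left ?_ hKpos.le)
      rw [logBregman] at hB
      linarith
    have hlog : log (exp (-x) * q) = log q - x := by
      rw [log_mul (exp_pos _).ne' hq.ne', log_exp]; ring
    rw [hlog] at h1
    have h6 := mul_le_mul_of_nonneg_left hA (exp_pos (-x)).le
    have h7 := mul_le_mul_of_nonneg_left h2 (mul_pos (exp_pos (-x)) hx).le
    linarith

/-! ### Decreasing rearrangement -/

theorem exists_perm_antitone {N : ℕ} {p : ℕ → ℝ} (hnn : ∀ k, 0 ≤ p k)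
    (hzero : ∀ k, N ≤ k → p k = 0) :
    ∃ s : Equiv.Perm ℕ, (∀ i, s i < N ↔ i < N) ∧ Antitone (fun i => p (s i)) := by
  set f : Fin N → ℝ := fun i => -p i with hf
  set σ := Tuple.sort f
  have hσ : Monotone (f ∘ σ) := Tuple.monotone_sort f
  set s : Equiv.Perm ℕ := σ.extendDomain Fin.equivSubtype with hs
  have h1 : ∀ i : Fin N, s i = σ i := fun i =>
    Equiv.Perm.extendDomain_apply_image σ Fin.equivSubtype i
  have h2 : ∀ i, N ≤ i → s i = i := fun i hi =>
    Equiv.Perm.extendDomain_apply_not_subtype σ Fin.equivSubtype (by omega)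
  refine ⟨s, fun i => ?_, fun i j hij => ?_⟩
  · rcases lt_or_ge i N with h | h
    · have := h1 ⟨i, h⟩
      simp only at this
      simp [this, h]
    · rw [h2 i h]
  · rcases lt_or_ge j N with h | h
    · have hi := h1 ⟨i, by omega⟩
      have hj := h1 ⟨j, h⟩
      simp only at hi hj
      have := hσ (show (⟨i, by omega⟩ : Fin N) ≤ ⟨j, h⟩ from hij)
      simp only [hf, Function.comp_apply] at this
      simp only [hi, hj]
      linarith
    · simp only [h2 j h, hzero j h]
      exact hnn _

/-- Abel summation. -/
theorem sum_mul_nonneg_of_sum_range_nonneg {N : ℕ} {e b : ℕ → ℝ}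
    (he : ∀ k ≤ N, 0 ≤ ∑ i ∈ range k, e i) (heN : ∑ i ∈ range N, e i = 0)
    (hb : ∀ i, i + 1 < N → b (i + 1) ≤ b i) : 0 ≤ ∑ i ∈ range N, e i * b i := by
  cases N with
  | zero => simp
  | succ N =>
    have key : ∀ n ≤ N, (∑ i ∈ range (n + 1), e i) * b n ≤ ∑ i ∈ range (n + 1), e i * b i := by
      intro n
      induction n with
      | zero => simp
      | succ n ih =>
        intro hn
        have h1 := ih (by omega)
        have h2 := mul_le_mul_of_nonneg_left (hb n (by omega)) (he (n + 1) (by omega))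
        rw [sum_range_succ, sum_range_succ (fun i => e i * b i), add_mul]
        linarith
    have := key N le_rfl
    rwa [heN, zero_mul] at this

/-- Under the death flow, the mass on the `k` largest entries grows at most as fast as when these
entries occupy `0, …, k - 1`; there the sum telescopes to the right side. -/
theorem sum_perm_le {N k : ℕ} {p : ℕ → ℝ} (hnn : ∀ k, 0 ≤ p k) (hzero : ∀ k, N ≤ k → p k = 0)
    {s : Equiv.Perm ℕ} (hs : ∀ i, s i < N ↔ i < N) (hanti : Antitone (fun i => p (s i)))
    (hk : k ≤ N) :
    ∑ i ∈ range k, (((s i : ℕ) + 1 : ℝ) * p (s i + 1) - s i * p (s i)) ≤ k * p (s k) := by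
  set θ := p (s k) with hθ
  -- The excess over `θ` lives on the chosen `k` sites, and its flow summed over all sites vanishes;
  -- the constant level `θ` contributes `θ` per site.
  set u : ℕ → ℝ := fun m => max (p m - θ) 0 with hu
  have hθ0 : 0 ≤ θ := hnn _
  have huN : u N = 0 := by simp [hu, hzero N le_rfl, hθ0]
  have h1 : ∑ i ∈ range k, (((s i : ℕ) + 1 : ℝ) * p (s i + 1) - s i * p (s i)) ≤
      ∑ i ∈ range k, (((s i : ℕ) + 1 : ℝ) * u (s i + 1) - s i * u (s i) + θ) := by
    refine sum_le_sum fun i hi => ?_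
    have hik : θ ≤ p (s i) := hanti (mem_range.1 hi).le
    have h2 : u (s i) = p (s i) - θ := max_eq_left (by linarith)
    have h3 : p (s i + 1) - θ ≤ u (s i + 1) := le_max_left _ _
    have h4 := mul_le_mul_of_nonneg_left h3 (show (0 : ℝ) ≤ (s i : ℕ) + 1 by positivity)
    rw [h2]
    linarith
  have h2 : ∑ i ∈ range k, ((s i : ℕ) + 1 : ℝ) * u (s i + 1) ≤
      ∑ i ∈ range k, (s i : ℝ) * u (s i) := by
    calc ∑ i ∈ range k, ((s i : ℕ) + 1 : ℝ) * u (s i + 1)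
        ≤ ∑ i ∈ range N, ((s i : ℕ) + 1 : ℝ) * u (s i + 1) :=
          sum_le_sum_of_subset_of_nonneg (range_subset_range.2 hk) fun i _ _ =>
            mul_nonneg (by positivity) (le_max_right _ _)
      _ = ∑ n ∈ range N, ((n : ℝ) + 1) * u (n + 1) :=
          sum_equiv s (by simp [hs]) fun i _ => rfl
      _ = ∑ n ∈ range N, (n : ℝ) * u n := sum_succ_mul_succ huN
      _ = ∑ i ∈ range N, (s i : ℝ) * u (s i) :=
          (sum_equiv s (by simp [hs]) fun i _ => rfl).symm
      _ = ∑ i ∈ range k, (s i : ℝ) * u (s i) := by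
          refine (sum_subset (range_subset_range.2 hk) fun i _ hi => ?_).symm
          have : p (s i) ≤ θ := hanti (by simpa using hi)
          simp [hu, this]
  refine h1.trans ?_
  rw [sum_add_distrib, sum_sub_distrib]
  simp only [sum_const, card_range, nsmul_eq_mul]
  linarith

/-- Abel summation of the flow differences, whose partial sums are controlled by `sum_perm_le`,
against the decreasing weights `log p (s i)`. -/
theorem production_le_production_perm {N : ℕ} {p : ℕ → ℝ} (hpos : ∀ k < N, 0 < p k)
    (hzero : ∀ k, N ≤ k → p k = 0) {s : Equiv.Perm ℕ} (hs : ∀ i, s i < N ↔ i < N)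
    (hanti : Antitone (fun i => p (s i))) :
    production N p ≤ production N (fun i => p (s i)) := by
  have hnn : ∀ k, 0 ≤ p k := fun k => by
    rcases lt_or_ge k N with h | h
    exacts [(hpos k h).le, (hzero k h).ge]
  have hsN : p (s N) = 0 := hzero _ (not_lt.1 fun h => lt_irrefl N ((hs N).1 h))
  have htel : ∀ (f : ℕ → ℝ) (k : ℕ), ∑ i ∈ range k, (((i : ℝ) + 1) * f (i + 1) - i * f i) =
      k * f k := fun f k => by
    have := sum_range_sub (fun i : ℕ => (i : ℝ) * f i) k
    push_cast at this
    rw [this]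
    ring
  have h1 : production N p = ∑ i ∈ range N,
      (((s i : ℕ) + 1 : ℝ) * p (s i + 1) - s i * p (s i)) * log (p (s i)) :=
    (sum_equiv s (by simp [hs]) fun i _ => rfl).symm
  rw [h1, production, ← sub_nonneg, ← sum_sub_distrib]
  simp only [← sub_mul]
  refine sum_mul_nonneg_of_sum_range_nonneg (fun k hk => ?_) ?_ fun i hi => ?_
  · rw [sum_sub_distrib, htel (fun i => p (s i)), sub_nonneg]
    exact sum_perm_le hnn hzero hs hanti hk
  · have h2 : ∑ i ∈ range N, (((s i : ℕ) + 1 : ℝ) * p (s i + 1) - s i * p (s i)) = 0 := by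
      rw [sum_equiv s (t := range N) (g := fun n : ℕ => ((n : ℝ) + 1) * p (n + 1) - n * p n)
        (by simp [hs]) (fun i _ => rfl), htel, hzero N le_rfl, mul_zero]
    rw [sum_sub_distrib, htel (fun i => p (s i)), h2, hsN]
    simp
  · exact log_le_log (hpos _ ((hs _).2 hi)) (hanti (Nat.le_succ i))

theorem production_le {N : ℕ} {p : ℕ → ℝ} (hpos : ∀ k < N, 0 < p k)
    (hzero : ∀ k, N ≤ k → p k = 0) (hsum : ∑ k ∈ range N, p k = 1)
    {E : ℝ} (hE : 0 < E) (hH : ∑ k ∈ range N, negMulLog (p k) ≤ gReal E) :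
    production N p ≤ E * log ((E + 1) / E) := by
  have hnn : ∀ k, 0 ≤ p k := fun k => by
    rcases lt_or_ge k N with h | h
    exacts [(hpos k h).le, (hzero k h).ge]
  obtain ⟨s, hs, hanti⟩ := exists_perm_antitone hnn hzero
  refine (production_le_production_perm hpos hzero hs hanti).trans
    (production_le_of_antitone (fun k hk => hpos _ ((hs k).2 hk))
      (fun k hk => hzero _ (not_lt.1 fun h => hk.not_gt ((hs k).1 h))) hanti ?_ hE ?_)
  · rw [← hsum]
    exact sum_equiv s (by simp [hs]) fun i _ => rfl
  · refine le_trans (le_of_eq ?_) hH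
    exact sum_equiv s (by simp [hs]) fun i _ => rfl

/-! ### The inequality along the thinning flow, finite support -/

/-- Up to the first point where `u ≥ 0`, `u` is negative and hence decreasing, so it cannot start
below zero. -/
theorem nonneg_of_deriv_nonpos_of_neg {u u' : ℝ → ℝ} {a b : ℝ} (hab : a ≤ b)
    (hc : ContinuousOn u (Set.Icc a b)) (hd : ∀ x ∈ Set.Ioo a b, HasDerivAt u (u' x) x)
    (hu : ∀ x ∈ Set.Ioo a b, u x < 0 → u' x ≤ 0) (hb : 0 ≤ u b) : 0 ≤ u a := by
  have hclosed : IsClosed (Set.Icc a b ∩ u ⁻¹' Set.Ici 0) :=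
    hc.preimage_isClosed_of_isClosed isClosed_Icc isClosed_Ici
  have hcomp : IsCompact (Set.Icc a b ∩ u ⁻¹' Set.Ici 0) :=
    isCompact_Icc.of_isClosed_subset hclosed Set.inter_subset_left
  obtain ⟨c, ⟨hc1, hc2⟩, hleast⟩ := hcomp.exists_isLeast ⟨b, ⟨hab, le_rfl⟩, hb⟩
  have hanti : AntitoneOn u (Set.Icc a c) := by
    refine antitoneOn_of_deriv_nonpos (convex_Icc a c)
      (hc.mono (Set.Icc_subset_Icc_right hc1.2)) ?_ ?_ <;> rw [interior_Icc] <;> intro x hx <;>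
      have hx' : x ∈ Set.Ioo a b := ⟨hx.1, hx.2.trans_le hc1.2⟩
    · exact (hd x hx').differentiableAt.differentiableWithinAt
    · rw [(hd x hx').deriv]
      refine hu x hx' (not_le.1 fun h => hx.2.not_ge (hleast ⟨⟨hx'.1.le, hx'.2.le⟩, h⟩))
  exact le_trans hc2 (hanti ⟨le_rfl, hc1.1⟩ ⟨hc1.1, le_rfl⟩ hc1.1)

/-- The probability that a binomial variable with parameters `k` and `l` equals `n`. -/
noncomputable def binom (k n : ℕ) (l : ℝ) : ℝ := k.choose n * l ^ n * (1 - l) ^ (k - n)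

theorem binom_nonneg (k n : ℕ) {l : ℝ} (h0 : 0 ≤ l) (h1 : l ≤ 1) : 0 ≤ binom k n l := by
  have : 0 ≤ 1 - l := by linarith
  unfold binom
  positivity

theorem binom_one (k n : ℕ) : binom k n 1 = if k = n then 1 else 0 := by
  rcases lt_trichotomy k n with h | rfl | h
  · simp [binom, Nat.choose_eq_zero_of_lt h, h.ne]
  · simp [binom]
  · have : k - n ≠ 0 := by omega
    simp [binom, this, h.ne']

theorem sum_binom {N k : ℕ} (hk : k < N) (l : ℝ) : ∑ n ∈ range N, binom k n l = 1 := by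
  have h := add_pow l (1 - l) k
  rw [add_sub_cancel, one_pow] at h
  rw [h]
  symm
  refine (sum_congr rfl fun n _ => ?_).trans
    (sum_subset (range_subset_range.2 hk) fun n _ hn => ?_)
  · rw [binom]; ring
  · rw [binom, Nat.choose_eq_zero_of_lt (by simpa [Nat.lt_succ_iff] using hn)]
    simp

theorem hasDerivAt_binom (k n : ℕ) {l : ℝ} (hl : l ≠ 0) :
    HasDerivAt (binom k n) ((n * binom k n l - (n + 1) * binom k (n + 1) l) / l) l := by
  have h := ((hasDerivAt_pow n l).const_mul (k.choose n : ℝ)).fun_mul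
    (((hasDerivAt_id l).const_sub 1).fun_pow (k - n))
  refine h.congr_deriv ?_
  have h1 : (n : ℝ) * l ^ (n - 1) = n * l ^ n / l := by
    cases n with
    | zero => simp
    | succ n => rw [Nat.add_sub_cancel, pow_succ]; field_simp
  have h2 : ((n : ℝ) + 1) * k.choose (n + 1) = k.choose n * (k - n : ℕ) := by
    have := Nat.choose_succ_right_eq k n
    have h3 : ((k.choose (n + 1) * (n + 1) : ℕ) : ℝ) = ((k.choose n * (k - n) : ℕ) : ℝ) := by
      rw [this]
    push_cast at h3 ⊢
    linarith
  rw [h1, binom, binom, Nat.sub_add_eq, eq_div_iff hl]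
  simp only [id]
  have h4 : ((n : ℝ) + 1) * (k.choose (n + 1) * l ^ (n + 1) * (1 - l) ^ (k - n - 1)) =
      k.choose n * (k - n : ℕ) * l ^ (n + 1) * (1 - l) ^ (k - n - 1) := by
    rw [← h2]; ring
  rw [h4]
  field_simp
  ring

/-- The thinning of a finitely supported sequence. -/
noncomputable def thinSeq (N : ℕ) (p : ℕ → ℝ) (l : ℝ) (n : ℕ) : ℝ :=
  ∑ k ∈ range N, p k * binom k n l

theorem hasDerivAt_thinSeq (N : ℕ) (p : ℕ → ℝ) (n : ℕ) {l : ℝ} (hl : l ≠ 0) :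
    HasDerivAt (fun l => thinSeq N p l n)
      ((n * thinSeq N p l n - (n + 1) * thinSeq N p l (n + 1)) / l) l := by
  have := HasDerivAt.fun_sum (u := range N) fun k _ => (hasDerivAt_binom k n hl).const_mul (p k)
  refine this.congr_deriv ?_
  rw [thinSeq, thinSeq, mul_sum, mul_sum, ← sum_sub_distrib, sum_div]
  exact sum_congr rfl fun k _ => by ring

theorem thinSeq_of_le {N n : ℕ} (p : ℕ → ℝ) (l : ℝ) (h : N ≤ n) : thinSeq N p l n = 0 :=
  sum_eq_zero fun k hk => by
    rw [binom, Nat.choose_eq_zero_of_lt ((mem_range.1 hk).trans_le h)]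
    simp

theorem thinSeq_one {N n : ℕ} {p : ℕ → ℝ} (hzero : ∀ k, N ≤ k → p k = 0) :
    thinSeq N p 1 n = p n := by
  simp only [thinSeq, binom_one, mul_ite, mul_one, mul_zero, sum_ite_eq', mem_range]
  split_ifs with h
  exacts [rfl, (hzero n (not_lt.1 h)).symm]

theorem sum_thinSeq (N : ℕ) (p : ℕ → ℝ) (l : ℝ) :
    ∑ n ∈ range N, thinSeq N p l n = ∑ k ∈ range N, p k := by
  simp only [thinSeq]
  rw [sum_comm]
  exact sum_congr rfl fun k hk => by rw [← mul_sum, sum_binom (mem_range.1 hk), mul_one]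

theorem thinSeq_nonneg {N : ℕ} {p : ℕ → ℝ} (hnn : ∀ k, 0 ≤ p k) {l : ℝ} (h0 : 0 ≤ l)
    (h1 : l ≤ 1) (n : ℕ) : 0 ≤ thinSeq N p l n :=
  sum_nonneg fun k _ => mul_nonneg (hnn k) (binom_nonneg k n h0 h1)

theorem thinSeq_pos {N : ℕ} {p : ℕ → ℝ} (hnn : ∀ k, 0 ≤ p k) (htop : 0 < p N) {l : ℝ} (h0 : 0 < l)
    (h1 : l < 1) {n : ℕ} (hn : n < N + 1) : 0 < thinSeq (N + 1) p l n := by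
  refine sum_pos' (fun k _ => mul_nonneg (hnn k) (binom_nonneg k n h0.le h1.le))
    ⟨N, self_mem_range_succ N, mul_pos htop ?_⟩
  have h2 : 0 < 1 - l := by linarith
  have h3 : 0 < N.choose n := Nat.choose_pos (by omega)
  unfold binom
  positivity

theorem hasDerivAt_gReal {x : ℝ} (hx : 0 < x) : HasDerivAt gReal (log ((x + 1) / x)) x := by
  have h1 : HasDerivAt (fun x : ℝ => (x + 1) * log (x + 1)) (log (x + 1) + 1) x := by
    simpa using (hasDerivAt_mul_log (x := x + 1) (by positivity)).comp_add_const x 1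
  refine (h1.fun_sub (hasDerivAt_mul_log hx.ne')).congr_deriv ?_
  rw [log_div (by positivity) hx.ne']
  ring

theorem gReal_le_sum_negMulLog_thinSeq_of_pos {N : ℕ} {p : ℕ → ℝ} (hnn : ∀ k, 0 ≤ p k)
    (htop : 0 < p N) (hzero : ∀ k, N + 1 ≤ k → p k = 0) (hsum : ∑ k ∈ range (N + 1), p k = 1)
    {E : ℝ} (hE : 0 < E) (hH : ∑ k ∈ range (N + 1), negMulLog (p k) = gReal E)
    {l : ℝ} (h0 : 0 < l) (h1 : l ≤ 1) :
    gReal (l * E) ≤ ∑ n ∈ range (N + 1), negMulLog (thinSeq (N + 1) p l n) := by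
  set b := thinSeq (N + 1) p with hb
  set u : ℝ → ℝ := fun l => ∑ n ∈ range (N + 1), negMulLog (b l n) - gReal (l * E) with hu
  have hcb : ∀ n, Continuous fun l => b l n := fun n => by
    simp only [hb, thinSeq, binom]
    fun_prop
  have hcu : Continuous u :=
    (continuous_finsetSum _ fun n _ => continuous_negMulLog.comp (hcb n)).sub
      (continuous_gReal.comp (by fun_prop))
  refine sub_nonneg.1 (nonneg_of_deriv_nonpos_of_neg (u := u)
    (u' := fun x => (production (N + 1) (b x) - x * E * log ((x * E + 1) / (x * E))) / x) h1
    hcu.continuousOn (fun x hx => ?_) (fun x hx hux => ?_) ?_)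
  · have hx0 : 0 < x := h0.trans hx.1
    have hpos : ∀ n < N + 1, 0 < b x n := fun n hn => thinSeq_pos hnn htop hx0 hx.2 hn
    have hd := (HasDerivAt.fun_sum (u := range (N + 1)) fun n hn =>
      (hasDerivAt_negMulLog (hpos n (mem_range.1 hn)).ne').comp x
        (hasDerivAt_thinSeq (N + 1) p n hx0.ne')).fun_sub
      ((hasDerivAt_gReal (mul_pos hx0 hE)).comp x ((hasDerivAt_id x).mul_const E))
    refine hd.congr_deriv ?_
    have htel : ∑ i ∈ range (N + 1), (((i : ℝ) + 1) * b x (i + 1) - i * b x i) = 0 := by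
      have := sum_range_sub (fun i : ℕ => (i : ℝ) * b x i) (N + 1)
      rw [hb, thinSeq_of_le p x le_rfl, ← hb] at this
      push_cast at this
      rw [this]
      ring
    have hprod : ∑ n ∈ range (N + 1), (-log (b x n) - 1) *
        ((n * b x n - (n + 1) * b x (n + 1)) / x) = production (N + 1) (b x) / x := by
      rw [← add_zero (production (N + 1) (b x)), ← htel, production, ← sum_add_distrib, sum_div]
      exact sum_congr rfl fun n _ => by ring
    change ∑ n ∈ range (N + 1), (-log (b x n) - 1) *
        ((n * b x n - (n + 1) * b x (n + 1)) / x) - _ = _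
    rw [hprod]
    simp only [one_mul]
    field_simp
  · have hx0 : 0 < x := h0.trans hx.1
    -- `u x < 0` supplies the entropy hypothesis of `production_le` at mean `x * E`.
    refine div_nonpos_of_nonpos_of_nonneg (sub_nonpos.2 ?_) hx0.le
    exact production_le (fun n hn => thinSeq_pos hnn htop hx0 hx.2 hn)
      (fun n hn => thinSeq_of_le p x hn) ((sum_thinSeq (N + 1) p x).trans hsum) (mul_pos hx0 hE)
      (sub_nonpos.1 hux.le)
  · simp only [hu, hb, thinSeq_one hzero, one_mul, hH, sub_self, le_refl]

/-- Vanishing top entries are discarded until the last one is positive, which makes every thinned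
entry positive for `0 < l < 1`. -/
theorem gReal_le_sum_negMulLog_thinSeq {N : ℕ} {p : ℕ → ℝ} (hnn : ∀ k, 0 ≤ p k)
    (hzero : ∀ k, N ≤ k → p k = 0) (hsum : ∑ k ∈ range N, p k = 1)
    {E : ℝ} (hE : 0 ≤ E) (hH : ∑ k ∈ range N, negMulLog (p k) = gReal E)
    {l : ℝ} (h0 : 0 ≤ l) (h1 : l ≤ 1) :
    gReal (l * E) ≤ ∑ n ∈ range N, negMulLog (thinSeq N p l n) := by
  rcases (mul_nonneg h0 hE).eq_or_lt with h | h
  · rw [← h, gReal_zero]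
    refine sum_nonneg fun n hn => negMulLog_nonneg (thinSeq_nonneg hnn h0 h1 n) ?_
    rw [← hsum, ← sum_thinSeq N p l]
    exact single_le_sum (fun n _ => thinSeq_nonneg hnn h0 h1 n) hn
  have hl : 0 < l := h0.lt_of_ne (by rintro rfl; simp at h)
  have hE : 0 < E := hE.lt_of_ne (by rintro rfl; simp at h)
  induction N with
  | zero => simp at hsum
  | succ N ih =>
    rcases (hnn N).eq_or_lt with hN | hN
    · have hthin : ∀ n, thinSeq (N + 1) p l n = thinSeq N p l n := fun n => by
        simp [thinSeq, sum_range_succ, ← hN]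
      simp only [sum_range_succ _ N, hthin, thinSeq_of_le p l le_rfl, ← hN, negMulLog_zero,
        add_zero] at hsum hH ⊢
      refine ih (fun k hk => ?_) hsum hH
      rcases hk.eq_or_lt with rfl | hk
      exacts [hN.symm, hzero k hk]
    · exact gReal_le_sum_negMulLog_thinSeq_of_pos hnn hN hzero hsum hE hH hl h1

/-! ### Geometric distributions -/

theorem g_coe (E : ℝ≥0) : g E = ENNReal.ofReal (gReal E) := by
  change gFun E = _
  simp [gFun]

theorem g_ofReal {x : ℝ} (hx : 0 ≤ x) : g (ENNReal.ofReal x) = ENNReal.ofReal (gReal x) := by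
  rw [ENNReal.ofReal, g_coe, Real.coe_toNNReal x hx]

theorem entropy_geom (E : ℝ≥0) : entropy (geom E) = g E := by
  have hterm : ∀ n, ((geom E) n).toReal = 1 / ((E : ℝ) + 1) * ((E : ℝ) / ((E : ℝ) + 1)) ^ n :=
    fun n => by rw [geom_apply, ENNReal.toReal_ofReal (by positivity)]
  rw [g_coe, entropy]
  simp only [hterm]
  rcases eq_or_ne E 0 with rfl | hE
  · simp only [NNReal.coe_zero, gReal_zero, ENNReal.ofReal_zero, ENNReal.tsum_eq_zero]
    intro n
    rcases eq_or_ne n 0 with rfl | hn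
    · simp
    · simp [hn]
  have hE : 0 < (E : ℝ) := by positivity
  generalize (E : ℝ) = x at hE ⊢
  set L := log ((x + 1) / x) with hL
  have hq1 : x / (x + 1) < 1 := by rw [div_lt_one (by positivity)]; linarith
  have h1 : ∀ n : ℕ, negMulLog (1 / (x + 1) * (x / (x + 1)) ^ n) =
      1 / (x + 1) * log (x + 1) * (x / (x + 1)) ^ n +
        1 / (x + 1) * L * (n * (x / (x + 1)) ^ n) := fun n => by
    rw [negMulLog, log_mul (by positivity) (by positivity), log_pow, hL, ← inv_div x (x + 1),
      log_inv, one_div, log_inv]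
    ring
  have h2 : HasSum (fun n : ℕ => negMulLog (1 / (x + 1) * (x / (x + 1)) ^ n)) (gReal x) := by
    simp only [h1]
    have h3 := (hasSum_geometric_of_lt_one (by positivity) hq1).mul_left
      (1 / (x + 1) * log (x + 1))
    have h4 := (hasSum_coe_mul_geometric_of_norm_lt_one
      (by rwa [norm_of_nonneg (by positivity)] : ‖x / (x + 1)‖ < 1)).mul_left (1 / (x + 1) * L)
    have h5 : 1 - x / (x + 1) = 1 / (x + 1) := by field_simp; ring
    have h6 : gReal x = 1 / (x + 1) * log (x + 1) * (1 - x / (x + 1))⁻¹ +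
        1 / (x + 1) * L * (x / (x + 1) / (1 - x / (x + 1)) ^ 2) := by
      rw [gReal_eq_log_add hE, ← hL, h5]
      field_simp
    rw [h6]
    exact h3.add h4
  have h6 : ∀ n : ℕ, 0 ≤ negMulLog (1 / (x + 1) * (x / (x + 1)) ^ n) := fun n =>
    negMulLog_nonneg (by positivity) (mul_le_one₀
      (by rw [div_le_one (by positivity)]; linarith) (by positivity)
      (pow_le_one₀ (by positivity) hq1.le))
  rw [← ENNReal.ofReal_tsum_of_nonneg h6 h2.summable, h2.tsum_eq]

/-- Negative binomial series of ratio `E (1 - l) / (E + 1)`, after the shift `k = n + m`. -/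
theorem hasSum_geometric_mul_binom {E l : ℝ} (hE : 0 ≤ E) (h0 : 0 ≤ l) (h1 : l ≤ 1) (n : ℕ) :
    HasSum (fun k => 1 / (E + 1) * (E / (E + 1)) ^ k * binom k n l)
      (1 / (l * E + 1) * (l * E / (l * E + 1)) ^ n) := by
  have hE1 : 0 < E + 1 := by linarith
  have hl1 : 0 ≤ 1 - l := by linarith
  have hlE : 0 < l * E + 1 := by positivity
  set r := E / (E + 1) * (1 - l) with hr
  have hr0 : 0 ≤ r := by positivity
  have hr1 : 1 - r = (l * E + 1) / (E + 1) := by rw [hr]; field_simp; ring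
  have hr2 : ‖r‖ < 1 := by
    have : 0 < 1 - r := by rw [hr1]; positivity
    rw [norm_of_nonneg hr0]
    linarith
  have h := (hasSum_choose_mul_geometric_of_norm_lt_one n hr2).mul_left
    (1 / (E + 1) * (l * (E / (E + 1))) ^ n)
  have hshift := (hasSum_nat_add_iff (f := fun k => 1 / (E + 1) * (E / (E + 1)) ^ k * binom k n l)
    n (g := 1 / (l * E + 1) * (l * E / (l * E + 1)) ^ n)).1 ?_
  · rwa [sum_eq_zero, add_zero] at hshift
    intro k hk
    rw [binom, Nat.choose_eq_zero_of_lt (mem_range.1 hk)]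
    simp
  · have hval : 1 / (l * E + 1) * (l * E / (l * E + 1)) ^ n =
        1 / (E + 1) * (l * (E / (E + 1))) ^ n * (1 / (1 - r) ^ (n + 1)) := by
      rw [hr1, div_pow, mul_pow, mul_pow, div_pow, div_pow, pow_succ, pow_succ]
      field_simp
    rw [hval]
    refine h.congr_fun fun m => ?_
    rw [binom, Nat.add_sub_cancel, hr, mul_pow, mul_pow, pow_add]
    ring

theorem thin_geom (l : unitInterval) (E : ℝ≥0) :
    thin l (geom E) = geom (Real.toNNReal l * E) := by
  ext n
  have h := hasSum_geometric_mul_binom E.coe_nonneg l.2.1 l.2.2 n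
  rw [thin_apply, geom_apply]
  push_cast
  rw [Real.coe_toNNReal _ l.2.1, ← h.tsum_eq, ENNReal.ofReal_tsum_of_nonneg _ h.summable]
  · refine tsum_congr fun k => ?_
    rw [geom_apply, ← ENNReal.ofReal_mul (by positivity)]
    rfl
  · intro k
    exact mul_nonneg (by positivity) (binom_nonneg k n l.2.1 l.2.2)

/-! ### Truncation and passage to the limit -/

/-- `t` is a mixture of `a` and some `b` in `[0, 1]` with weights `α` and `1 - α`; concavity
applies, and the `b` term is nonnegative. -/
theorem negMulLog_ge_of_mem_Icc {α a t : ℝ} (hα : α ∈ Set.Icc (0 : ℝ) 1) (ha : 0 ≤ a)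
    (ht : t ∈ Set.Icc (α * a) (α * a + (1 - α))) : α * negMulLog a ≤ negMulLog t := by
  rcases hα.2.eq_or_lt with rfl | hα1
  · have : t = a := by linarith [ht.1, ht.2]
    simp [this]
  have h1 : 0 < 1 - α := by linarith
  have hb0 : 0 ≤ (t - α * a) / (1 - α) := div_nonneg (by linarith [ht.1]) h1.le
  have hb1 : (t - α * a) / (1 - α) ≤ 1 := (div_le_one h1).2 (by linarith [ht.2])
  have h := concaveOn_negMulLog.2 (Set.mem_Ici.2 ha) (Set.mem_Ici.2 hb0) hα.1 h1.le (by ring)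
  simp only [smul_eq_mul] at h
  have h2 : α * a + (1 - α) * ((t - α * a) / (1 - α)) = t := by field_simp; ring
  rw [h2] at h
  linarith [mul_nonneg h1.le (negMulLog_nonneg hb0 hb1)]

theorem binom_le_one (k n : ℕ) {l : ℝ} (h0 : 0 ≤ l) (h1 : l ≤ 1) : binom k n l ≤ 1 := by
  rw [← sum_binom (show k < k + n + 1 by omega) l]
  exact single_le_sum (f := fun n => binom k n l) (fun n _ => binom_nonneg k n h0 h1)
    (mem_range.2 (by omega))

theorem hasSum_toReal (p : PMF ℕ) : HasSum (fun k => (p k).toReal) 1 := by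
  have h := ENNReal.hasSum_toReal p.tsum_coe_ne_top
  rwa [← ENNReal.tsum_toReal_eq p.apply_ne_top, p.tsum_coe, ENNReal.toReal_one] at h

theorem toReal_le_one (p : PMF ℕ) (k : ℕ) : (p k).toReal ≤ 1 :=
  le_hasSum (hasSum_toReal p) k fun _ _ => ENNReal.toReal_nonneg

theorem thin_toReal_mem_Icc (l : unitInterval) (p : PMF ℕ) (N n : ℕ) :
    (thin l p n).toReal ∈ Set.Icc (∑ k ∈ range N, (p k).toReal * binom k n l)
      (∑ k ∈ range N, (p k).toReal * binom k n l + (1 - ∑ k ∈ range N, (p k).toReal)) := by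
  have hp := hasSum_toReal p
  have hle : ∀ k, (p k).toReal * binom k n l ≤ (p k).toReal := fun k =>
    mul_le_of_le_one_right ENNReal.toReal_nonneg (binom_le_one k n l.2.1 l.2.2)
  have hnn : ∀ k, 0 ≤ (p k).toReal * binom k n l := fun k =>
    mul_nonneg ENNReal.toReal_nonneg (binom_nonneg k n l.2.1 l.2.2)
  have hs : Summable fun k => (p k).toReal * binom k n l := hp.summable.of_nonneg_of_le hnn hle
  have ht : (thin l p n).toReal = ∑' k, (p k).toReal * binom k n l := by
    rw [thin_apply, ENNReal.tsum_toReal_eq fun k =>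
      ENNReal.mul_ne_top (p.apply_ne_top k) ENNReal.ofReal_ne_top]
    refine tsum_congr fun k => ?_
    rw [ENNReal.toReal_mul]
    congr 1
    exact ENNReal.toReal_ofReal (binom_nonneg k n l.2.1 l.2.2)
  rw [ht, ← hs.sum_add_tsum_nat_add N, ← hp.tsum_eq, ← hp.summable.sum_add_tsum_nat_add N]
  have h1 : 0 ≤ ∑' k, (p (k + N)).toReal * binom (k + N) n l := tsum_nonneg fun k => hnn _
  have h2 : ∑' k, (p (k + N)).toReal * binom (k + N) n l ≤ ∑' k, (p (k + N)).toReal :=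
    ((summable_nat_add_iff N).2 hs).tsum_le_tsum (fun k => hle _)
      ((summable_nat_add_iff N).2 hp.summable)
  constructor <;> linarith

theorem le_entropy_thin_of_truncation (l : unitInterval) (p : PMF ℕ) {N : ℕ}
    (hN : 0 < ∑ k ∈ range N, (p k).toReal) :
    ENNReal.ofReal (∑ k ∈ range N, (p k).toReal) *
        g (ENNReal.ofReal l * g.symm (ENNReal.ofReal (∑ k ∈ range N, negMulLog (p k).toReal) -
          ENNReal.ofReal (-log (∑ k ∈ range N, (p k).toReal)))) ≤
      entropy (thin l p) := by
  set a : ℕ → ℝ := fun k => (p k).toReal with ha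
  change 0 < ∑ k ∈ range N, a k at hN
  change ENNReal.ofReal (∑ k ∈ range N, a k) *
    g (ENNReal.ofReal l * g.symm (ENNReal.ofReal (∑ k ∈ range N, negMulLog (a k)) -
      ENNReal.ofReal (-log (∑ k ∈ range N, a k)))) ≤ _
  have ha0 : ∀ k, 0 ≤ a k := fun k => ENNReal.toReal_nonneg
  have hsum := hasSum_toReal p
  have ha1 : ∀ k, a k ≤ 1 := toReal_le_one p
  have hα1 : ∑ k ∈ range N, a k ≤ 1 := sum_le_hasSum _ (fun j _ => ha0 j) hsum
  have hmem := fun n => thin_toReal_mem_Icc l p N n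
  change ∀ n, _ ∈ Set.Icc (∑ k ∈ range N, a k * binom k n l)
    (∑ k ∈ range N, a k * binom k n l + (1 - ∑ k ∈ range N, a k)) at hmem
  set α := ∑ k ∈ range N, a k with hα
  set P : ℕ → ℝ := fun k => if k < N then a k / α else 0 with hP
  have hPlt : ∀ k ∈ range N, P k = a k / α := fun k hk => if_pos (mem_range.1 hk)
  have hP0 : ∀ k, 0 ≤ P k := fun k => by
    simp only [hP]
    split_ifs
    exacts [div_nonneg (ha0 k) hN.le, le_rfl]
  have hPsum : ∑ k ∈ range N, P k = 1 := by
    rw [sum_congr rfl hPlt, ← sum_div, ← hα, div_self hN.ne']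
  have hP1 : ∀ k ∈ range N, P k ≤ 1 := fun k hk => by
    rw [← hPsum]
    exact single_le_sum (fun k _ => hP0 k) hk
  obtain ⟨E, hE, hgE⟩ := exists_gReal_eq (y := ∑ k ∈ range N, negMulLog (P k))
    (sum_nonneg fun k hk => negMulLog_nonneg (hP0 k) (hP1 k hk))
  have hfin := gReal_le_sum_negMulLog_thinSeq hP0 (fun k hk => if_neg hk.not_gt) hPsum hE hgE.symm
    l.2.1 l.2.2
  -- The normalized truncation has entropy `(∑ negMulLog aₖ) / α + log α`; the division is dropped
  -- since `α ≤ 1`.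
  have hent : ∑ k ∈ range N, negMulLog (a k) + log α ≤ gReal E := by
    have h1 : ∀ k ∈ range N, negMulLog (P k) = negMulLog (a k) / α + a k / α * log α := by
      intro k hk
      rw [hPlt k hk]
      rcases eq_or_ne (a k) 0 with h | h
      · simp [h]
      · rw [negMulLog, log_div h hN.ne', negMulLog]
        ring
    rw [hgE, sum_congr rfl h1, sum_add_distrib, ← sum_mul, ← sum_div, ← sum_div, ← hα,
      div_self hN.ne', one_mul]
    have h2 : 0 ≤ ∑ k ∈ range N, negMulLog (a k) :=
      sum_nonneg fun k _ => negMulLog_nonneg (ha0 k) (ha1 k)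
    have := le_div_self h2 hN hα1
    linarith
  have hthin : ∀ n, α * negMulLog (thinSeq N P l n) ≤ negMulLog (thin l p n).toReal := by
    intro n
    refine negMulLog_ge_of_mem_Icc ⟨hN.le, hα1⟩ (thinSeq_nonneg hP0 l.2.1 l.2.2 n) ?_
    have : α * thinSeq N P l n = ∑ k ∈ range N, a k * binom k n l := by
      rw [thinSeq, mul_sum]
      refine sum_congr rfl fun k hk => ?_
      rw [hPlt k hk]
      field_simp
    rw [this]
    exact hmem n
  have hle1 : ENNReal.ofReal (∑ k ∈ range N, negMulLog (a k)) - ENNReal.ofReal (-log α) ≤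
      g (ENNReal.ofReal E) := by
    rw [g_ofReal hE, tsub_le_iff_right, ← ENNReal.ofReal_add (gReal_nonneg hE)
      (neg_nonneg.2 (log_nonpos hN.le hα1))]
    exact ENNReal.ofReal_le_ofReal (by linarith)
  calc ENNReal.ofReal α * g (ENNReal.ofReal l * g.symm
        (ENNReal.ofReal (∑ k ∈ range N, negMulLog (a k)) - ENNReal.ofReal (-log α)))
      ≤ ENNReal.ofReal α * g (ENNReal.ofReal l * ENNReal.ofReal E) := by
        refine mul_le_mul_right (g.monotone (mul_le_mul_right ?_ _)) _
        exact (g.symm_apply_le).2 hle1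
    _ = ENNReal.ofReal (α * gReal (l * E)) := by
        rw [← ENNReal.ofReal_mul l.2.1, g_ofReal (mul_nonneg l.2.1 hE), ENNReal.ofReal_mul hN.le]
    _ ≤ ENNReal.ofReal (∑ n ∈ range N, negMulLog (thin l p n).toReal) := by
        refine ENNReal.ofReal_le_ofReal ((mul_le_mul_of_nonneg_left hfin hN.le).trans ?_)
        rw [mul_sum]
        exact sum_le_sum fun n _ => hthin n
    _ ≤ ∑ n ∈ range N, ENNReal.ofReal (negMulLog (thin l p n).toReal) :=
        (ENNReal.ofReal_sum_of_nonneg fun n _ =>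
          negMulLog_nonneg ENNReal.toReal_nonneg (toReal_le_one _ n)).le
    _ ≤ entropy (thin l p) := ENNReal.sum_le_tsum _

/-- As `N → ∞` the truncated mass tends to `1` and the truncated entropy sum to `H(p)`. Order
isomorphisms of `[0, ∞]` are continuous, so the limit covers `H(p) = ∞` too. -/
theorem g_mul_symm_entropy_le (l : unitInterval) (p : PMF ℕ) :
    g (ENNReal.ofReal l * g.symm (entropy p)) ≤ entropy (thin l p) := by
  have hα : Tendsto (fun N => ∑ k ∈ range N, (p k).toReal) atTop (𝓝 1) :=
    (hasSum_toReal p).tendsto_sum_nat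
  have hlog : Tendsto (fun N => ENNReal.ofReal (-log (∑ k ∈ range N, (p k).toReal))) atTop
      (𝓝 0) := by
    have := ENNReal.tendsto_ofReal ((hα.log one_ne_zero).neg)
    simpa using this
  have hS : Tendsto (fun N => ENNReal.ofReal (∑ k ∈ range N, negMulLog (p k).toReal)) atTop
      (𝓝 (entropy p)) := by
    have h := ENNReal.tendsto_nat_tsum fun k => ENNReal.ofReal (negMulLog (p k).toReal)
    refine h.congr fun N => (ENNReal.ofReal_sum_of_nonneg fun k _ => ?_).symm
    exact negMulLog_nonneg ENNReal.toReal_nonneg (toReal_le_one p k)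
  have hsub := ENNReal.Tendsto.sub hS hlog (Or.inr ENNReal.zero_ne_top)
  rw [tsub_zero] at hsub
  have h1 := (g.continuous.tendsto _).comp (ENNReal.Tendsto.const_mul (a := ENNReal.ofReal l)
    ((g.symm.continuous.tendsto _).comp hsub) (Or.inr ENNReal.ofReal_ne_top))
  have h2 := ENNReal.Tendsto.mul (ENNReal.tendsto_ofReal hα) (Or.inl (by simp)) h1
    (Or.inr (by simp))
  rw [ENNReal.ofReal_one, one_mul] at h2
  refine le_of_tendsto h2 ?_
  filter_upwards [hα.eventually (lt_mem_nhds one_pos)] with N hN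
  exact le_entropy_thin_of_truncation l p hN

theorem entropy_thin_geom (l : unitInterval) (E : ℝ≥0) :
    entropy (thin l (geom E)) =
      g (ENNReal.ofReal l * g.symm (entropy (geom E))) := by
  rw [thin_geom, entropy_geom, entropy_geom, OrderIso.symm_apply_apply, ENNReal.coe_mul]
  rfl

theorem exists_entropy_geom_eq {S : ℝ≥0∞} (hS : S ≠ ⊤) : ∃ E : ℝ≥0, entropy (geom E) = S := by
  obtain ⟨x, hx, hxS⟩ := exists_gReal_eq (y := S.toReal) ENNReal.toReal_nonneg
  refine ⟨x.toNNReal, ?_⟩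
  rw [entropy_geom, g_coe, Real.coe_toNNReal x hx, hxS, ENNReal.ofReal_toReal hS]

end Thinning

theorem mainTheorem5 (l : unitInterval) :
    (∀ p : PMF ℕ,
      Thinning.g (ENNReal.ofReal (l : ℝ) * Thinning.g.symm (Thinning.entropy p)) ≤
        Thinning.entropy (Thinning.thin l p)) ∧
    (∀ E : ℝ≥0,
      Thinning.entropy (Thinning.thin l (Thinning.geom E)) =
          Thinning.g
            (ENNReal.ofReal (l : ℝ) * Thinning.g.symm (Thinning.entropy (Thinning.geom E))) ∧
        ∀ p : PMF ℕ, Thinning.entropy p = Thinning.entropy (Thinning.geom E) →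
          Thinning.entropy (Thinning.thin l (Thinning.geom E)) ≤
            Thinning.entropy (Thinning.thin l p)) ∧
    (∀ S : ℝ≥0∞, S ≠ ⊤ → ∃ E : ℝ≥0, Thinning.entropy (Thinning.geom E) = S) := by
  refine ⟨Thinning.g_mul_symm_entropy_le l, fun E => ⟨Thinning.entropy_thin_geom l E, ?_⟩,
    fun S hS => Thinning.exists_entropy_geom_eq hS⟩
  intro p hp
  rw [Thinning.entropy_thin_geom, ← hp]
  exact Thinning.g_mul_symm_entropy_le l p
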